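/- For $k\ge 1$ let $M_k(\mathbb C)$ be the algebra of complex $k\times k$ matrices with the Hilbert--Schmidt inner product $\langle B,C\rangle=\mathrm{Tr}\,B^*C$. For positive semidefinite $\rho_1,\rho_2\in M_k(\mathbb C)$ let $\Delta(\rho_1/\rho_2)$ be the positive linear operator on $M_k(\mathbb C)$ given by $\Delta(\rho_1/\rho_2)B=\rho_1B\rho_2^{-1}$, where $\rho_2^{-1}$ is the inverse of $\rho_2$ (if $\rho_2$ is singular, its inverse on its support, extended by $0$ on its kernel). For $f:[0,\infty)\to\mathbb R$ and $A\in M_k(\mathbb C)$ the quasi-entropy is $$S^A_f(\rho_1\|\rho_2)=\big\langle A\rho_2^{1/2},\,f(\Delta(\rho_1/\rho_2))(A\rho_2^{1/2})\big\rangle .$$ A function $f:[0,\infty)\to\mathbb R$ is operator monotone if $0\le X\le Y$ implies $f(X)\le f(Y)$ for complex matrices $X,Y$ of every size. **Theorem.** Let $f:[0,\infty)\to\mathbb R$ be operator monotone with $f(0)\ge 0$. Let $\alpha:M_m(\mathbb C)\to M_n(\mathbb C)$ be a unital Schwarz mapping, i.e. a linear map with $\alpha(I)=I$ and $\alpha(B)^*\alpha(B)\le\alpha(B^*B)$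 for all $B\in M_m(\mathbb C)$, and let $\alpha^*:M_n(\mathbb C)\to M_m(\mathbb C)$ be its dual with respect to the Hilbert--Schmidt inner products. Then $$S^A_f(\alpha^*(\rho_1)\|\alpha^*(\rho_2))\ \ge\ S^{\alpha(A)}_f(\rho_1\|\rho_2)$$ for every $A\in M_m(\mathbb C)$ and all invertible density matrices (positive definite, trace one) $\rho_1,\rho_2\in M_n(\mathbb C)$. -/

import Mathlib

open scoped MatrixOrder ComplexOrder

noncomputable section

/-- `f : [0, ∞) → ℝ` is operator monotone: `0 ≤ A ≤ B` implies `f(A) ≤ f(B)` for complex matrices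
of every size. Only the values of `f` on `[0, ∞)` matter. -/
def OperatorMonotone (f : ℝ → ℝ) : Prop :=
  ∀ (k : ℕ) (A B : Matrix (Fin k) (Fin k) ℂ), 0 ≤ A → A ≤ B → cfc f A ≤ cfc f B

/-- Schwarz mappings between matrix algebras: `α(B)^* α(B) ≤ α(B^* B)` for every `B`. Such a map
is positive, hence `α(B^*) = α(B)^*`, see `IsSchwarzMap.map_conjTranspose`. -/
def IsSchwarzMap {m n : Type*} [Fintype m] [Fintype n]
    (α : Matrix m m ℂ →ₗ[ℂ] Matrix n n ℂ) : Prop :=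
  ∀ B : Matrix m m ℂ, (α B).conjTranspose * α B ≤ α (B.conjTranspose * B)

theorem IsSchwarzMap.map_conjTranspose {m n : Type*} [Fintype m] [DecidableEq m] [Fintype n]
    {α : Matrix m m ℂ →ₗ[ℂ] Matrix n n ℂ} (hα : IsSchwarzMap α) (B : Matrix m m ℂ) :
    α B.conjTranspose = (α B).conjTranspose := by
  have h (C : Matrix m m ℂ) : (α (C.conjTranspose * C)).IsHermitian := by
    have h1 := Matrix.le_iff.1 (hα C)
    have h2 := h1.isHermitian.add (Matrix.isHermitian_conjTranspose_mul_self (α C))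
    rwa [sub_add_cancel] at h2
  have e1 := (h (1 + B)).eq
  have e2 := (h (1 + Complex.I • B)).eq
  have e0 := (h B).eq
  have e3 := (h 1).eq
  simp only [Matrix.conjTranspose_add, Matrix.conjTranspose_one, Matrix.conjTranspose_smul,
    Matrix.add_mul, Matrix.mul_add, Matrix.one_mul, Matrix.mul_one, map_add, map_smul,
    Matrix.smul_mul, Matrix.mul_smul] at e0 e1 e2 e3
  ext i j
  have a0 := congrFun (congrFun e0 i) j
  have a1 := congrFun (congrFun e1 i) j
  have a2 := congrFun (congrFun e2 i) j
  have a3 := congrFun (congrFun e3 i) j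
  simp only [Matrix.add_apply, Matrix.conjTranspose_apply, Matrix.smul_apply, smul_eq_mul,
    RCLike.star_def, Complex.conj_I, map_neg] at a0 a1 a2 a3 ⊢
  rw [a3, a0] at a1 a2
  linear_combination (-1 / 2 : ℂ) * a1 - (Complex.I / 2) * a2 + (1 / 2 : ℂ) *
    ((starRingEnd ℂ) (α B.conjTranspose j i) - (starRingEnd ℂ) (α B j i)
      + α B.conjTranspose i j - α B i j) * Complex.I_mul_I

/-- The Hilbert-Schmidt inner product `⟨B, C⟩ = Tr B^* C`. -/
def hsInner {n : Type*} [Fintype n] (B C : Matrix n n ℂ) : ℂ :=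
  (B.conjTranspose * C).trace

/-- The dual `α^*` of `α` with respect to the Hilbert-Schmidt inner products, given by its
entries `⟨E i j, α^* Y⟩ = ⟨α (E i j), Y⟩`, where the `E i j` are the matrix units. -/
def hsDual {m n : Type*} [Fintype m] [DecidableEq m] [Fintype n]
    (α : Matrix m m ℂ →ₗ[ℂ] Matrix n n ℂ) : Matrix n n ℂ →ₗ[ℂ] Matrix m m ℂ where
  toFun Y := Matrix.of fun i j => hsInner (α (Matrix.single i j 1)) Y
  map_add' Y Z := by
    ext i j
    simp [hsInner, Matrix.mul_add]
  map_smul' c Y := by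
    ext i j
    simp [hsInner]

/-- `α^*` is the adjoint of `α`. -/
theorem hsInner_hsDual {m n : Type*} [Fintype m] [DecidableEq m] [Fintype n]
    (α : Matrix m m ℂ →ₗ[ℂ] Matrix n n ℂ) (X : Matrix m m ℂ) (Y : Matrix n n ℂ) :
    hsInner X (hsDual α Y) = hsInner (α X) Y := by
  have h : α X = ∑ i, ∑ j, X i j • α (Matrix.single i j 1) := by
    conv_lhs => rw [Matrix.matrix_eq_sum_single X]
    simp only [map_sum]
    refine Finset.sum_congr rfl fun i _ => Finset.sum_congr rfl fun j _ => ?_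
    rw [← map_smul, Matrix.smul_single, smul_eq_mul, mul_one]
  rw [h]
  simp only [hsInner, hsDual, LinearMap.coe_mk, AddHom.coe_mk, Matrix.conjTranspose_sum,
    Matrix.conjTranspose_smul, Matrix.sum_mul, Matrix.trace_sum, Matrix.smul_mul,
    Matrix.trace_smul, smul_eq_mul]
  rw [Finset.sum_comm]
  simp [Matrix.trace, Matrix.mul_apply]

/-- The inverse of a positive semidefinite matrix on its support (and `0` on its kernel). For a
positive definite matrix it is the inverse, see `supportInv_eq_inv`. -/
def supportInv {n : Type*} [Fintype n] [DecidableEq n] (ρ : Matrix n n ℂ) : Matrix n n ℂ :=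
  cfc (fun x : ℝ => x⁻¹) ρ

theorem supportInv_eq_inv {n : Type*} [Fintype n] [DecidableEq n] {ρ : Matrix n n ℂ}
    (hρ : ρ.PosDef) : supportInv ρ = ρ⁻¹ := by
  have hu : IsUnit ρ := hρ.isUnit
  have hs : IsSelfAdjoint ρ := hρ.isHermitian
  have h : cfc (fun x : ℝ => x * x⁻¹) ρ = 1 := by
    rw [← cfc_one ℝ ρ]
    refine cfc_congr fun x hx => ?_
    have : x ≠ 0 := by
      rintro rfl
      exact spectrum.zero_notMem ℝ hu hx
    simp [this]
  rw [cfc_mul (fun x : ℝ => x) (fun x : ℝ => x⁻¹) ρ continuousOn_id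
    (Matrix.finite_real_spectrum.continuousOn _), cfc_id' ℝ ρ] at h
  exact (Matrix.inv_eq_right_inv h).symm

/-- The relative modular operator `Δ(ρ₁/ρ₂) B = ρ₁ B ρ₂⁻¹`. -/
def relModular {n : Type*} [Fintype n] [DecidableEq n] (ρ₁ ρ₂ : Matrix n n ℂ) :
    Matrix n n ℂ →ₗ[ℂ] Matrix n n ℂ :=
  LinearMap.mulLeft ℂ ρ₁ ∘ₗ LinearMap.mulRight ℂ (supportInv ρ₂)

/-- The functional calculus `f(T)` of a linear map `T` on matrices that is self-adjoint for the
Hilbert-Schmidt inner product, computed in the orthonormal basis of the matrix units. -/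
def hsFunctionalCalculus {n : Type*} [Fintype n] [DecidableEq n] (f : ℝ → ℝ)
    (T : Matrix n n ℂ →ₗ[ℂ] Matrix n n ℂ) : Matrix n n ℂ →ₗ[ℂ] Matrix n n ℂ :=
  Matrix.toLin (Matrix.stdBasis ℂ n n) (Matrix.stdBasis ℂ n n)
    (cfc f (LinearMap.toMatrix (Matrix.stdBasis ℂ n n) (Matrix.stdBasis ℂ n n) T))

/-- The quasi-entropy `⟨A ρ₂^{1/2}, f(Δ(ρ₁/ρ₂)) (A ρ₂^{1/2})⟩`. -/
def quasiEntropy {n : Type*} [Fintype n] [DecidableEq n] (f : ℝ → ℝ) (A ρ₁ ρ₂ : Matrix n n ℂ) :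
    ℂ :=
  hsInner (A * CFC.sqrt ρ₂) (hsFunctionalCalculus f (relModular ρ₁ ρ₂) (A * CFC.sqrt ρ₂))

end

/-! Write σᵢ = α^*(ρᵢ). The map V : Bσ₂^{1/2} ↦ α(B)ρ₂^{1/2}, extended by 0, is a contraction
(`hsInner_transferMap_le`) and satisfies V^*Δ(ρ₁/ρ₂)V ≤ Δ(σ₁/σ₂)
(`trace_relModular_transferMap_le`). Both are the Schwarz inequality paired with a state: for B
against ρ₂, for B^* against ρ₁. Hansen's inequality together with monotonicity
(`contraction_compression_le`) gives V^*f(Δ(ρ₁/ρ₂))V ≤ f(Δ(σ₁/σ₂)), and the quadratic form at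
Aσ₂^{1/2} is the claim.

Hansen's inequality is derived from matrix monotonicity alone: dilate V to an isometry, dominate by
a pinching at the cost of a factor 1 + δ², and let δ → 0. The factor leaves f by the scalar bound
`apply_mul_le`, so continuity of f is never needed. -/

namespace Matrix

/-! ### Functional calculus and intertwining matrices. -/

section Intertwining

variable {ι κ : Type*} [Fintype ι] [DecidableEq ι] [Fintype κ] [DecidableEq κ]

/-- On self-adjoint matrices with a common finite set containing the spectra, the functional
calculus is evaluation of one polynomial. -/
theorem exists_polynomial_cfc_eq (f : ℝ → ℝ) {X : Matrix ι ι ℂ} {D : Matrix κ κ ℂ}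
    (hX : X.IsHermitian) (hD : D.IsHermitian) :
    ∃ p : Polynomial ℝ, cfc f X = Polynomial.aeval X p ∧ cfc f D = Polynomial.aeval D p := by
  classical
  have hX' : IsSelfAdjoint X := hX
  have hD' : IsSelfAdjoint D := hD
  set s : Finset ℝ := (finite_real_spectrum (A := X)).toFinset ∪
    (finite_real_spectrum (A := D)).toFinset with hs
  have hp : ∀ x ∈ s, f x = (Lagrange.interpolate s id f).eval x := fun x hx =>
    (Lagrange.eval_interpolate_at_node (v := id) f Function.injective_id.injOn hx).symm
  refine ⟨Lagrange.interpolate s id f, ?_, ?_⟩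
  · rw [← cfc_polynomial _ X hX']
    exact cfc_congr fun x hx => hp x (by simp [hs, hx])
  · rw [← cfc_polynomial _ D hD']
    exact cfc_congr fun x hx => hp x (by simp [hs, hx])

theorem aeval_mul_of_intertwining {X : Matrix ι ι ℂ} {D : Matrix κ κ ℂ} {J : Matrix ι κ ℂ}
    (h : X * J = J * D) (p : Polynomial ℝ) :
    Polynomial.aeval X p * J = J * Polynomial.aeval D p := by
  induction p using Polynomial.induction_on' with
  | add p q hp hq => simp [Matrix.add_mul, Matrix.mul_add, hp, hq]
  | monomial k c =>
    have hk : X ^ k * J = J * D ^ k := by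
      induction k with
      | zero => simp
      | succ k ih =>
        rw [pow_succ, Matrix.mul_assoc, h, ← Matrix.mul_assoc, ih, Matrix.mul_assoc, ← pow_succ]
    simp [Polynomial.aeval_monomial, Algebra.algebraMap_eq_smul_one, hk]

/-- A matrix that intertwines two self-adjoint matrices intertwines their functional calculi. -/
theorem cfc_mul_of_intertwining (f : ℝ → ℝ) {X : Matrix ι ι ℂ} {D : Matrix κ κ ℂ}
    {J : Matrix ι κ ℂ} (hX : X.IsHermitian) (hD : D.IsHermitian) (h : X * J = J * D) :
    cfc f X * J = J * cfc f D := by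
  obtain ⟨p, h₁, h₂⟩ := exists_polynomial_cfc_eq f hX hD
  rw [h₁, h₂, aeval_mul_of_intertwining h]

end Intertwining

/-! ### Compressions and pinching. -/

section

variable {ι κ : Type*} [Fintype ι] [Fintype κ]

theorem conjTranspose_mul_mul_le {X Y : Matrix ι ι ℂ} (h : X ≤ Y) (K : Matrix ι κ ℂ) :
    K.conjTranspose * X * K ≤ K.conjTranspose * Y * K := by
  have := (Matrix.le_iff.1 h).conjTranspose_mul_mul_same K
  rw [Matrix.le_iff]
  simpa [Matrix.mul_sub, Matrix.sub_mul] using this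

theorem mul_mul_conjTranspose_le {X Y : Matrix ι ι ℂ} (h : X ≤ Y) (K : Matrix κ ι ℂ) :
    K * X * K.conjTranspose ≤ K * Y * K.conjTranspose := by
  simpa using conjTranspose_mul_mul_le h K.conjTranspose

/-- Pinching by a projection `P` dominates a positive semidefinite matrix, up to constants. -/
theorem PosSemidef.le_pinching [DecidableEq ι] {X P : Matrix ι ι ℂ} (hX : X.PosSemidef) (hP : P.IsHermitian)
    {δ : ℝ} (hδ : δ ≠ 0) :
    X ≤ (1 + δ ^ 2) • (P * X * P) + (1 + (δ⁻¹) ^ 2) • ((1 - P) * X * (1 - P)) := by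
  -- The weights δ and δ⁻¹ make the off-diagonal blocks of BXB exactly those of -X, so they cancel
  -- in X + BXB.
  set B := δ • P - δ⁻¹ • (1 - P) with hB
  have hBH : B.conjTranspose = B := by
    simp [hB, hP.eq]
  have := hX.conjTranspose_mul_mul_same B
  rw [hBH] at this
  rw [Matrix.le_iff]
  refine (congrArg PosSemidef (?_ : _ = B * X * B)).mpr this
  have hδ' : δ * δ⁻¹ = 1 := mul_inv_cancel₀ hδ
  have h1 : P + (1 - P) = 1 := by simp
  generalize 1 - P = Q at *
  have h2 : X = (P + Q) * X * (P + Q) := by simp [h1]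
  rw [sub_eq_iff_eq_add]
  refine Eq.trans ?_ (congrArg (_ + ·) h2.symm)
  simp only [hB, Matrix.sub_mul, Matrix.mul_sub, Matrix.add_mul, Matrix.mul_add,
    Matrix.smul_mul, Matrix.mul_smul, smul_sub, smul_smul, hδ', mul_comm δ⁻¹ δ]
  module

end

end Matrix

/-! ### Hansen's inequality. -/

namespace OperatorMonotone

open Matrix

variable {f : ℝ → ℝ}

/-- Passes from `Fin k` to any finite index type: the reindexing matrix J intertwines Z with JZJ^*.
-/
theorem cfc_le {ι : Type*} [Fintype ι] [DecidableEq ι] (hf : OperatorMonotone f)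
    {X Y : Matrix ι ι ℂ} (hX : 0 ≤ X) (hXY : X ≤ Y) : cfc f X ≤ cfc f Y := by
  let e := Fintype.equivFin ι
  let J : Matrix (Fin (Fintype.card ι)) ι ℂ := (1 : Matrix ι ι ℂ).submatrix e.symm id
  have hJ : J.conjTranspose * J = 1 := by
    simp [J, Matrix.conjTranspose_submatrix, Matrix.submatrix_mul_equiv]
  have key (Z : Matrix ι ι ℂ) (hZ : 0 ≤ Z) :
      J.conjTranspose * cfc f (J * Z * J.conjTranspose) * J = cfc f Z := by
    have hZ' : Z.IsHermitian := (Matrix.nonneg_iff_posSemidef.1 hZ).isHermitian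
    rw [Matrix.mul_assoc, cfc_mul_of_intertwining f (D := Z)
      (Matrix.isHermitian_mul_mul_conjTranspose J hZ') hZ'
      (by rw [Matrix.mul_assoc, hJ, Matrix.mul_one]), ← Matrix.mul_assoc, hJ, Matrix.one_mul]
  rw [← key X hX, ← key Y (hX.trans hXY)]
  refine conjTranspose_mul_mul_le (hf _ _ _ ?_ (mul_mul_conjTranspose_le hXY J)) J
  simpa using mul_mul_conjTranspose_le hX J

variable {ι κ : Type*} [Fintype ι] [DecidableEq ι] [Fintype κ] [DecidableEq κ]

/-- Hansen's inequality for an isometry `K`. -/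
theorem isometry_compression_le (hf : OperatorMonotone f) {X : Matrix ι ι ℂ} {D : Matrix κ κ ℂ}
    {K : Matrix ι κ ℂ} (hK : K.conjTranspose * K = 1) (hX : 0 ≤ X)
    (h : K.conjTranspose * X * K ≤ D) {δ : ℝ} (hδ : δ ≠ 0) :
    K.conjTranspose * cfc f X * K ≤ cfc f ((1 + δ ^ 2) • D) := by
  have hX' := Matrix.nonneg_iff_posSemidef.1 hX
  set P := K * K.conjTranspose with hP
  have hPH : P.IsHermitian := isHermitian_mul_conjTranspose_self K
  have hPK : P * K = K := by rw [hP, Matrix.mul_assoc, hK, Matrix.mul_one]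
  -- Y dominates X and is block diagonal for P, with corner (1 + δ²)D on the range of K, so f(Y)
  -- compresses to f of that corner.
  set Y := (1 + δ ^ 2) • (K * D * K.conjTranspose) +
    (1 + (δ⁻¹) ^ 2) • ((1 - P) * X * (1 - P)) with hY
  have hXY : X ≤ Y := by
    refine (hX'.le_pinching hPH hδ).trans ?_
    have hle : P * X * P ≤ K * D * K.conjTranspose := by
      simpa [hP, Matrix.mul_assoc] using mul_mul_conjTranspose_le h K
    exact add_le_add_left (smul_le_smul_of_nonneg_left hle (by positivity)) _
  have hD : 0 ≤ D := by
    refine le_trans ?_ h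
    simpa using conjTranspose_mul_mul_le hX K
  have hYK : Y * K = K * ((1 + δ ^ 2) • D) := by
    have : (1 - P) * K = 0 := by rw [Matrix.sub_mul, hPK, Matrix.one_mul, sub_self]
    simp [hY, Matrix.add_mul, Matrix.mul_assoc, this, hK]
  refine (conjTranspose_mul_mul_le (hf.cfc_le hX hXY) K).trans_eq ?_
  have hDH : ((1 + δ ^ 2) • D).IsHermitian :=
    (Matrix.nonneg_iff_posSemidef.1 (smul_nonneg (by positivity) hD)).isHermitian
  rw [Matrix.mul_assoc, cfc_mul_of_intertwining f
    (Matrix.nonneg_iff_posSemidef.1 (hX.trans hXY)).isHermitian hDH hYK, ← Matrix.mul_assoc, hK,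
    Matrix.one_mul]

/-- Hansen's inequality for a contraction `V`. -/
theorem contraction_compression_le_dilated (hf : OperatorMonotone f) (hf0 : 0 ≤ f 0)
    {D : Matrix ι ι ℂ} {E : Matrix κ κ ℂ} {V : Matrix ι κ ℂ} (hV : V.conjTranspose * V ≤ 1)
    (hD : 0 ≤ D) (h : V.conjTranspose * D * V ≤ E) {δ : ℝ} (hδ : δ ≠ 0) :
    V.conjTranspose * cfc f D * V ≤ cfc f ((1 + δ ^ 2) • E) := by
  have hDp := Matrix.nonneg_iff_posSemidef.1 hD
  -- W^*W = 1 - V^*V, so that the column K = (V, W) below is an isometry; X below is D ⊕ 0.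
  obtain ⟨W, hW⟩ := CStarAlgebra.nonneg_iff_eq_star_mul_self.1 (sub_nonneg.2 hV)
  rw [Matrix.star_eq_conjTranspose] at hW
  set J₁ : Matrix (ι ⊕ κ) ι ℂ := fromRows 1 0 with hJ₁
  set J₂ : Matrix (ι ⊕ κ) κ ℂ := fromRows 0 1 with hJ₂
  have h11 : J₁.conjTranspose * J₁ = 1 := by
    simp [hJ₁, conjTranspose_fromRows_eq_fromCols_conjTranspose, fromCols_mul_fromRows]
  have h12 : J₁.conjTranspose * J₂ = 0 := by
    simp [hJ₁, hJ₂, conjTranspose_fromRows_eq_fromCols_conjTranspose, fromCols_mul_fromRows]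
  have h21 : J₂.conjTranspose * J₁ = 0 := by
    simp [hJ₁, hJ₂, conjTranspose_fromRows_eq_fromCols_conjTranspose, fromCols_mul_fromRows]
  have h22 : J₂.conjTranspose * J₂ = 1 := by
    simp [hJ₂, conjTranspose_fromRows_eq_fromCols_conjTranspose, fromCols_mul_fromRows]
  set X := J₁ * D * J₁.conjTranspose with hX
  have hX0 : 0 ≤ X := by simpa using mul_mul_conjTranspose_le hD J₁
  have hXH := (Matrix.nonneg_iff_posSemidef.1 hX0).isHermitian
  have e₁ : cfc f X * J₁ = J₁ * cfc f D :=
    cfc_mul_of_intertwining f hXH hDp.isHermitian (by rw [hX, Matrix.mul_assoc, h11, Matrix.mul_one])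
  have e₂ : cfc f X * J₂ = J₂ * cfc f (0 : Matrix κ κ ℂ) :=
    cfc_mul_of_intertwining f hXH isHermitian_zero (by rw [hX, Matrix.mul_assoc, h12]; simp)
  set K := J₁ * V + J₂ * W with hK
  have compress (L₁ : Matrix ι κ ℂ) (L₂ : Matrix κ κ ℂ) :
      K.conjTranspose * (J₁ * L₁ + J₂ * L₂) = V.conjTranspose * L₁ + W.conjTranspose * L₂ := by
    rw [hK, conjTranspose_add, conjTranspose_mul, conjTranspose_mul, Matrix.add_mul,
      Matrix.mul_add, Matrix.mul_add, Matrix.mul_assoc, Matrix.mul_assoc, Matrix.mul_assoc,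
      Matrix.mul_assoc, ← Matrix.mul_assoc _ J₁, ← Matrix.mul_assoc _ J₂, ← Matrix.mul_assoc _ J₁,
      ← Matrix.mul_assoc _ J₂, h11, h12, h21, h22]
    simp
  have hKK : K.conjTranspose * K = 1 := by
    conv_lhs => rw [hK, ← hK, hK, compress]
    rw [← hW]; simp
  have hXK : K.conjTranspose * X * K = V.conjTranspose * D * V := by
    have : X * K = J₁ * (D * V) + J₂ * (0 : Matrix κ κ ℂ) := by
      rw [hX, hK, Matrix.mul_add, Matrix.mul_assoc, ← Matrix.mul_assoc _ J₁, h11,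
        Matrix.mul_assoc _ _ (J₂ * W), ← Matrix.mul_assoc _ J₂, h12]
      simp [Matrix.mul_assoc]
    rw [Matrix.mul_assoc, this, compress]
    simp [Matrix.mul_assoc]
  have hfK : K.conjTranspose * cfc f X * K =
      V.conjTranspose * cfc f D * V + f 0 • (W.conjTranspose * W) := by
    have : cfc f X * K = J₁ * (cfc f D * V) + J₂ * (f 0 • W) := by
      rw [hK, Matrix.mul_add, ← Matrix.mul_assoc, e₁, ← Matrix.mul_assoc, e₂, cfc_apply_zero,
        Algebra.algebraMap_eq_smul_one]
      simp [Matrix.mul_assoc]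
    rw [Matrix.mul_assoc, this, compress]
    simp [Matrix.mul_assoc]
  refine le_trans ?_ (hf.isometry_compression_le hKK hX0 (hXK.trans_le h) hδ)
  rw [hfK]
  -- f(D ⊕ 0) = f(D) ⊕ f(0), and f(0) ≥ 0 allows the term f(0)W^*W to be dropped.
  exact le_add_of_nonneg_right
    (smul_nonneg hf0 (Matrix.nonneg_iff_posSemidef.2 (posSemidef_conjTranspose_mul_self W)))

/-- The dilated Hansen inequality for 1 × 1 matrices bounds its own error factor: with c = 1 + δ², V
= c⁻¹ and D = cx, the compression is c⁻¹x, and the dilation by c brings it back to x. -/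
theorem apply_mul_le (hf : OperatorMonotone f) (hf0 : 0 ≤ f 0) {δ x : ℝ} (hδ : δ ≠ 0)
    (hx : 0 ≤ x) : f ((1 + δ ^ 2) * x) ≤ (1 + δ ^ 2) ^ 2 * f x := by
  set c := 1 + δ ^ 2 with hc
  have hc1 : 1 ≤ c := by rw [hc]; nlinarith [sq_nonneg δ]
  have hc0 : 0 < c := by linarith
  have scalar (a b : ℝ) : a • (1 : Matrix Unit Unit ℂ) ≤ b • 1 ↔ a ≤ b := by
    rw [Matrix.le_iff, ← sub_smul, ← sub_nonneg (a := b)]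
    refine ⟨fun h => ?_, fun h => PosSemidef.one.smul h⟩
    simpa using h.diag_nonneg (i := ())
  have cfc_scalar (r : ℝ) : cfc f (r • (1 : Matrix Unit Unit ℂ)) = f r • 1 := by
    rw [← Algebra.algebraMap_eq_smul_one, cfc_algebraMap, Algebra.algebraMap_eq_smul_one]
  have := hf.contraction_compression_le_dilated hf0 (D := (c * x) • (1 : Matrix Unit Unit ℂ))
    (E := (c⁻¹ * x) • (1 : Matrix Unit Unit ℂ)) (V := c⁻¹ • (1 : Matrix Unit Unit ℂ)) ?_ ?_ ?_ hδ
  · rw [← hc, smul_smul, mul_inv_cancel_left₀ hc0.ne', cfc_scalar, cfc_scalar] at this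
    simp only [conjTranspose_smul, conjTranspose_one, smul_mul_smul_comm, Matrix.mul_one, star_trivial,
      scalar] at this
    field_simp at this
    linarith
  · simp only [conjTranspose_smul, conjTranspose_one, smul_mul_smul_comm, Matrix.mul_one, star_trivial]
    rw [← one_smul ℝ (1 : Matrix Unit Unit ℂ), smul_smul, scalar]
    have := inv_le_one_of_one_le₀ hc1
    have := inv_pos.2 hc0
    nlinarith
  · rw [← zero_smul ℝ (1 : Matrix Unit Unit ℂ), scalar]
    positivity
  · simp only [conjTranspose_smul, conjTranspose_one, smul_mul_smul_comm, Matrix.mul_one, star_trivial]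
    rw [scalar]
    field_simp
    exact le_rfl

/-- Hansen's inequality, combined with monotonicity. -/
theorem contraction_compression_le (hf : OperatorMonotone f) (hf0 : 0 ≤ f 0)
    {D : Matrix ι ι ℂ} {E : Matrix κ κ ℂ} {V : Matrix ι κ ℂ} (hV : V.conjTranspose * V ≤ 1)
    (hD : 0 ≤ D) (h : V.conjTranspose * D * V ≤ E) :
    V.conjTranspose * cfc f D * V ≤ cfc f E := by
  have hE : 0 ≤ E := le_trans (by simpa using conjTranspose_mul_mul_le hD V) h
  have hEs : IsSelfAdjoint E := (Matrix.nonneg_iff_posSemidef.1 hE).isHermitian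
  have key (δ : ℝ) (hδ : δ ≠ 0) :
      V.conjTranspose * cfc f D * V ≤ ((1 + δ ^ 2) ^ 2) • cfc f E := by
    refine (hf.contraction_compression_le_dilated hf0 hV hD h hδ).trans ?_
    have hc (g : ℝ → ℝ) : ContinuousOn g (spectrum ℝ E) := finite_real_spectrum.continuousOn g
    rw [← cfc_comp_const_mul _ f E ((finite_real_spectrum.image _).continuousOn f) hEs,
      ← cfc_const_mul _ f E (hc f)]
    exact cfc_mono (fun x hx => hf.apply_mul_le hf0 hδ (spectrum_nonneg_of_nonneg hE hx))
      (hc _) (hc _)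
  have hG : (V.conjTranspose * cfc f D * V).IsHermitian :=
    isHermitian_conjTranspose_mul_mul V (cfc_predicate f D : IsSelfAdjoint _)
  refine Matrix.le_iff.2 (PosSemidef.of_dotProduct_mulVec_nonneg
    (IsHermitian.sub (cfc_predicate f E : IsSelfAdjoint _) hG) fun x => ?_)
  generalize V.conjTranspose * cfc f D * V = G at *
  -- Only the scalar (1 + δ²)² depends on δ, so the limit is taken in each quadratic form with f(E)
  -- fixed.
  have hlim : Filter.Tendsto (fun δ : ℝ => star x ⬝ᵥ (((1 + δ ^ 2) ^ 2) • cfc f E - G) *ᵥ x)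
      (nhdsWithin 0 {0}ᶜ) (nhds (star x ⬝ᵥ (cfc f E - G) *ᵥ x)) := by
    have : Continuous fun δ : ℝ => star x ⬝ᵥ (((1 + δ ^ 2) ^ 2) • cfc f E - G) *ᵥ x := by
      simp only [sub_mulVec, smul_mulVec, dotProduct_sub, dotProduct_smul]
      fun_prop
    simpa using (this.tendsto 0).mono_left nhdsWithin_le_nhds
  exact ge_of_tendsto hlim (Filter.eventually_of_mem self_mem_nhdsWithin fun δ hδ =>
    (Matrix.le_iff.1 (key δ hδ)).dotProduct_mulVec_nonneg x)

end OperatorMonotone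

open Matrix

/-! ### Hilbert–Schmidt coordinates and trace inequalities. -/

section HilbertSchmidt

variable {m n : Type*} [Fintype m] [Fintype n]

/-- The coordinates of a matrix in the basis of the matrix units. -/
def matrixUnitCoords (B : Matrix n n ℂ) : n × n → ℂ := fun p => B p.1 p.2

theorem star_matrixUnitCoords_dotProduct (B C : Matrix n n ℂ) :
    star (matrixUnitCoords B) ⬝ᵥ matrixUnitCoords C = hsInner B C := by
  simp only [dotProduct, matrixUnitCoords, hsInner, trace, diag_apply, mul_apply,
    conjTranspose_apply, Pi.star_apply, Fintype.sum_prod_type]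
  exact Finset.sum_comm

theorem stdBasis_repr_eq [DecidableEq n] (B : Matrix n n ℂ) :
    ⇑((stdBasis ℂ n n).repr B) = matrixUnitCoords B := by
  ext ⟨i, j⟩
  have : B = ∑ p : n × n, matrixUnitCoords B p • stdBasis ℂ n n p := by
    simp only [stdBasis_eq_single, Fintype.sum_prod_type, matrixUnitCoords, smul_single,
      smul_eq_mul, mul_one]
    exact matrix_eq_sum_single B
  conv_lhs => rw [this, Module.Basis.repr_sum_self]

theorem toMatrix_mulVec_matrixUnitCoords [DecidableEq m] [DecidableEq n]
    (T : Matrix m m ℂ →ₗ[ℂ] Matrix n n ℂ) (B : Matrix m m ℂ) :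
    LinearMap.toMatrix (stdBasis ℂ m m) (stdBasis ℂ n n) T *ᵥ matrixUnitCoords B =
      matrixUnitCoords (T B) := by
  rw [← stdBasis_repr_eq, ← stdBasis_repr_eq, LinearMap.toMatrix_mulVec_repr]

theorem matrixUnitCoords_of {n : Type*} (x : n × n → ℂ) :
    matrixUnitCoords (Matrix.of fun i j => x (i, j)) = x := rfl

theorem matrixUnitCoords_hsFunctionalCalculus [DecidableEq n] (f : ℝ → ℝ)
    (T : Matrix n n ℂ →ₗ[ℂ] Matrix n n ℂ) (B : Matrix n n ℂ) :
    matrixUnitCoords (hsFunctionalCalculus f T B) =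
      cfc f (LinearMap.toMatrix (stdBasis ℂ n n) (stdBasis ℂ n n) T) *ᵥ matrixUnitCoords B := by
  rw [← toMatrix_mulVec_matrixUnitCoords, hsFunctionalCalculus, LinearMap.toMatrix_toLin]

theorem star_dotProduct_conjTranspose_mul_mul_mulVec {ι κ : Type*} [Fintype ι] [Fintype κ]
    (V : Matrix ι κ ℂ) (D : Matrix ι ι ℂ) (x : κ → ℂ) :
    star x ⬝ᵥ (V.conjTranspose * D * V) *ᵥ x = star (V *ᵥ x) ⬝ᵥ D *ᵥ (V *ᵥ x) := by
  rw [star_mulVec, ← dotProduct_mulVec, mulVec_mulVec, mulVec_mulVec, Matrix.mul_assoc]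

theorem hsInner_self_nonneg (B : Matrix n n ℂ) : 0 ≤ hsInner B B :=
  (posSemidef_conjTranspose_mul_self B).trace_nonneg

theorem eq_zero_of_hsInner_self_eq_zero {B : Matrix n n ℂ} (h : hsInner B B = 0) : B = 0 :=
  trace_conjTranspose_mul_self_eq_zero_iff.1 h

theorem toMatrix_mulLeft_mulRight [DecidableEq n] (a b : Matrix n n ℂ) (p q : n × n) :
    LinearMap.toMatrix (stdBasis ℂ n n) (stdBasis ℂ n n)
      (LinearMap.mulLeft ℂ a ∘ₗ LinearMap.mulRight ℂ b) p q = a p.1 q.1 * b q.2 p.2 := by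
  rw [LinearMap.toMatrix_apply, stdBasis_repr_eq, stdBasis_eq_single]
  simp [matrixUnitCoords, Matrix.mul_apply, Matrix.single_apply, Finset.sum_ite_eq, ite_and]

theorem isHermitian_toMatrix_mulLeft_mulRight [DecidableEq n] {a b : Matrix n n ℂ}
    (ha : a.IsHermitian) (hb : b.IsHermitian) :
    (LinearMap.toMatrix (stdBasis ℂ n n) (stdBasis ℂ n n)
      (LinearMap.mulLeft ℂ a ∘ₗ LinearMap.mulRight ℂ b)).IsHermitian := by
  ext p q
  rw [conjTranspose_apply, toMatrix_mulLeft_mulRight, toMatrix_mulLeft_mulRight, star_mul',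
    ha.apply, hb.apply]

theorem trace_mul_nonneg {X Y : Matrix n n ℂ} (hX : 0 ≤ X) (hY : 0 ≤ Y) :
    0 ≤ (X * Y).trace := by
  classical
  obtain ⟨B, rfl⟩ := CStarAlgebra.nonneg_iff_eq_star_mul_self.1 hX
  rw [star_eq_conjTranspose, Matrix.mul_assoc, trace_mul_comm, Matrix.mul_assoc,
    ← Matrix.mul_assoc]
  exact ((Matrix.nonneg_iff_posSemidef.1 hY).mul_mul_conjTranspose_same B).trace_nonneg

theorem trace_mul_le {X X' Y : Matrix n n ℂ} (h : X ≤ X') (hY : 0 ≤ Y) :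
    (X * Y).trace ≤ (X' * Y).trace := by
  rw [← sub_nonneg, ← trace_sub, ← Matrix.sub_mul]
  exact trace_mul_nonneg (sub_nonneg.2 h) hY

end HilbertSchmidt

/-! ### The Schwarz inequality in dual form. -/

section Schwarz

variable {m n : Type*} [Fintype m] [DecidableEq m] [Fintype n]
  {α : Matrix m m ℂ →ₗ[ℂ] Matrix n n ℂ}

/-- The Schwarz inequality tested against ρ; the later estimates use it only in this form. -/
theorem IsSchwarzMap.trace_le (hα : IsSchwarzMap α) {ρ : Matrix n n ℂ} (hρ : 0 ≤ ρ)
    (B : Matrix m m ℂ) :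
    ((α B).conjTranspose * α B * ρ).trace ≤ (B.conjTranspose * B * hsDual α ρ).trace := by
  have h := hsInner_hsDual α (B.conjTranspose * B) ρ
  rw [hsInner, hsInner, ← hα.map_conjTranspose, conjTranspose_mul, conjTranspose_conjTranspose] at h
  rw [h]
  exact trace_mul_le (hα B) hρ

theorem IsSchwarzMap.hsDual_nonneg (hα : IsSchwarzMap α) {ρ : Matrix n n ℂ} (hρ : 0 ≤ ρ) :
    0 ≤ hsDual α ρ := by
  have hρH := (Matrix.nonneg_iff_posSemidef.1 hρ).isHermitian
  refine Matrix.nonneg_iff_posSemidef.2 (.of_dotProduct_mulVec_nonneg ?_ fun x => ?_)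
  · ext i j
    have h : single j i (1 : ℂ) = (single i j (1 : ℂ)).conjTranspose := by simp
    simp only [conjTranspose_apply, hsDual, LinearMap.coe_mk, AddHom.coe_mk, of_apply, hsInner]
    rw [h, hα.map_conjTranspose, ← trace_conjTranspose, conjTranspose_mul, hρH.eq,
      conjTranspose_conjTranspose, trace_mul_comm]
  · rcases isEmpty_or_nonempty m with h | ⟨⟨i⟩⟩
    · simp
    -- For B = eᵢx^* one has B^*B = xx^*, whose pairing with α^*(ρ) is the quadratic form at x.
    have := hα.trace_le hρ (vecMulVec (Pi.single i 1) (star x))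
    have h0 : 0 ≤ ((α (vecMulVec (Pi.single i 1) (star x))).conjTranspose *
        α (vecMulVec (Pi.single i 1) (star x)) * ρ).trace :=
      trace_mul_nonneg (Matrix.nonneg_iff_posSemidef.2 (posSemidef_conjTranspose_mul_self _)) hρ
    refine (h0.trans this).trans_eq ?_
    rw [conjTranspose_vecMulVec, vecMulVec_mul_vecMulVec]
    simp [vecMulVec_mul, trace_vecMulVec, dotProduct_mulVec, dotProduct_comm x]

end Schwarz

/-! ### Square roots and inverses on the support. -/

section SupportInv

variable {n : Type*} [Fintype n] [DecidableEq n] {σ : Matrix n n ℂ}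

/-- The inverse square root of a positive semidefinite matrix on its support. -/
noncomputable def supportInvSqrt (σ : Matrix n n ℂ) : Matrix n n ℂ :=
  cfc (fun x : ℝ => (√x)⁻¹) σ

theorem isHermitian_supportInvSqrt (σ : Matrix n n ℂ) : (supportInvSqrt σ).IsHermitian :=
  (cfc_predicate _ σ : IsSelfAdjoint _)

theorem isHermitian_supportInv (σ : Matrix n n ℂ) : (supportInv σ).IsHermitian :=
  (cfc_predicate _ σ : IsSelfAdjoint _)

theorem sqrt_eq_cfc (hσ : 0 ≤ σ) : CFC.sqrt σ = cfc Real.sqrt σ := by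
  rw [CFC.sqrt_eq_real_sqrt σ hσ, cfcₙ_eq_cfc]

theorem supportInvSqrt_mul_self (hσ : 0 ≤ σ) :
    supportInvSqrt σ * supportInvSqrt σ = supportInv σ := by
  have hc (g : ℝ → ℝ) : ContinuousOn g (spectrum ℝ σ) := finite_real_spectrum.continuousOn g
  rw [supportInvSqrt, supportInv, ← cfc_mul _ _ σ (hc _) (hc _)]
  refine cfc_congr fun x hx => ?_
  simp only [← mul_inv, Real.mul_self_sqrt (spectrum_nonneg_of_nonneg hσ hx)]

/-- The product is the support projection of σ. -/
theorem supportInvSqrt_mul_mul_supportInvSqrt_le (hσ : 0 ≤ σ) :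
    supportInvSqrt σ * σ * supportInvSqrt σ ≤ 1 := by
  have hσ' : IsSelfAdjoint σ := (Matrix.nonneg_iff_posSemidef.1 hσ).isHermitian
  have hc (g : ℝ → ℝ) : ContinuousOn g (spectrum ℝ σ) := finite_real_spectrum.continuousOn g
  have h : supportInvSqrt σ * σ * supportInvSqrt σ =
      cfc (fun x : ℝ => (√x)⁻¹ * x * (√x)⁻¹) σ := by
    rw [cfc_mul _ _ σ (hc _) (hc _), cfc_mul _ _ σ (hc _) (hc _), cfc_id' ℝ σ]
    rfl
  rw [h]
  refine cfc_le_one _ _ fun x hx => ?_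
  have hx0 := spectrum_nonneg_of_nonneg hσ hx
  rw [mul_right_comm, ← mul_inv, Real.mul_self_sqrt hx0]
  exact inv_mul_le_one

theorem sqrt_mul_supportInvSqrt_mul (hσ : 0 ≤ σ) :
    CFC.sqrt σ * supportInvSqrt σ * σ = σ := by
  have hσ' : IsSelfAdjoint σ := (Matrix.nonneg_iff_posSemidef.1 hσ).isHermitian
  have hc (g : ℝ → ℝ) : ContinuousOn g (spectrum ℝ σ) := finite_real_spectrum.continuousOn g
  have h : CFC.sqrt σ * supportInvSqrt σ * σ = cfc (fun x : ℝ => √x * (√x)⁻¹ * x) σ := by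
    rw [cfc_mul _ _ σ (hc _) (hc _), cfc_mul _ _ σ (hc _) (hc _), cfc_id' ℝ σ, sqrt_eq_cfc hσ]
    rfl
  rw [h]
  conv_rhs => rw [← cfc_id' ℝ σ]
  refine cfc_congr fun x hx => ?_
  rcases (spectrum_nonneg_of_nonneg hσ hx).eq_or_lt with rfl | h0
  · simp
  · simp [(Real.sqrt_pos.2 h0).ne']

theorem isHermitian_sqrt (σ : Matrix n n ℂ) : (CFC.sqrt σ).IsHermitian :=
  (Matrix.nonneg_iff_posSemidef.1 (CFC.sqrt_nonneg σ)).isHermitian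

theorem sqrt_mul_supportInv_mul_sqrt {ρ : Matrix n n ℂ} (hρ : ρ.PosDef) :
    CFC.sqrt ρ * supportInv ρ * CFC.sqrt ρ = 1 := by
  have h0 : 0 ≤ ρ := Matrix.nonneg_iff_posSemidef.2 hρ.posSemidef
  have hc (g : ℝ → ℝ) : ContinuousOn g (spectrum ℝ ρ) := finite_real_spectrum.continuousOn g
  rw [sqrt_eq_cfc h0, supportInv, ← cfc_mul _ _ ρ (hc _) (hc _), ← cfc_mul _ _ ρ (hc _) (hc _),
    ← cfc_one ℝ ρ hρ.isHermitian]
  refine cfc_congr fun x hx => ?_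
  have hx0 := spectrum_nonneg_of_nonneg h0 hx
  have hx1 : x ≠ 0 := by
    rintro rfl
    exact spectrum.zero_notMem ℝ hρ.isUnit hx
  simp only [Pi.one_apply]
  rw [mul_right_comm, Real.mul_self_sqrt hx0, mul_inv_cancel₀ hx1]

end SupportInv

/-! ### The matrix of the relative modular operator. -/

section Modular

variable {n : Type*} [Fintype n] [DecidableEq n]

/-- The matrix of the relative modular operator in the basis of the matrix units. -/
noncomputable def relModularMatrix (ρ₁ ρ₂ : Matrix n n ℂ) : Matrix (n × n) (n × n) ℂ :=
  LinearMap.toMatrix (stdBasis ℂ n n) (stdBasis ℂ n n) (relModular ρ₁ ρ₂)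

theorem quasiEntropy_eq_dotProduct (f : ℝ → ℝ) (A ρ₁ ρ₂ : Matrix n n ℂ) :
    quasiEntropy f A ρ₁ ρ₂ = star (matrixUnitCoords (A * CFC.sqrt ρ₂)) ⬝ᵥ
      cfc f (relModularMatrix ρ₁ ρ₂) *ᵥ matrixUnitCoords (A * CFC.sqrt ρ₂) := by
  rw [quasiEntropy, ← star_matrixUnitCoords_dotProduct, matrixUnitCoords_hsFunctionalCalculus,
    relModularMatrix]

theorem star_dotProduct_relModularMatrix_mulVec (ρ₁ ρ₂ B : Matrix n n ℂ) :
    star (matrixUnitCoords B) ⬝ᵥ relModularMatrix ρ₁ ρ₂ *ᵥ matrixUnitCoords B =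
      (B.conjTranspose * ρ₁ * B * supportInv ρ₂).trace := by
  rw [relModularMatrix, toMatrix_mulVec_matrixUnitCoords, star_matrixUnitCoords_dotProduct]
  simp [hsInner, relModular, Matrix.mul_assoc]

theorem isHermitian_relModularMatrix {ρ₁ : Matrix n n ℂ} (h₁ : ρ₁.IsHermitian)
    (ρ₂ : Matrix n n ℂ) : (relModularMatrix ρ₁ ρ₂).IsHermitian :=
  isHermitian_toMatrix_mulLeft_mulRight h₁ (isHermitian_supportInv ρ₂)

theorem relModularMatrix_nonneg {ρ₁ ρ₂ : Matrix n n ℂ} (h₁ : 0 ≤ ρ₁) (h₂ : 0 ≤ ρ₂) :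
    0 ≤ relModularMatrix ρ₁ ρ₂ := by
  have h₁' := Matrix.nonneg_iff_posSemidef.1 h₁
  refine Matrix.nonneg_iff_posSemidef.2
    (.of_dotProduct_mulVec_nonneg (isHermitian_relModularMatrix h₁'.isHermitian ρ₂) fun x => ?_)
  rw [← matrixUnitCoords_of x, star_dotProduct_relModularMatrix_mulVec]
  refine trace_mul_nonneg (Matrix.nonneg_iff_posSemidef.2 (h₁'.conjTranspose_mul_mul_same _))
    (cfc_nonneg fun x hx => inv_nonneg.2 (spectrum_nonneg_of_nonneg h₂ hx))

end Modular

/-! ### The contraction V and its two estimates. -/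

section Transfer

variable {m n : Type*} [Fintype m] [DecidableEq m] [Fintype n] [DecidableEq n]
  {α : Matrix m m ℂ →ₗ[ℂ] Matrix n n ℂ} {ρ₁ ρ₂ : Matrix n n ℂ}

/-- The map `B α^*(ρ)^{1/2} ↦ α(B) ρ^{1/2}`, extended by `0`. -/
noncomputable def transferMap (α : Matrix m m ℂ →ₗ[ℂ] Matrix n n ℂ) (ρ : Matrix n n ℂ) :
    Matrix m m ℂ →ₗ[ℂ] Matrix n n ℂ :=
  LinearMap.mulRight ℂ (CFC.sqrt ρ) ∘ₗ α ∘ₗ LinearMap.mulRight ℂ (supportInvSqrt (hsDual α ρ))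

theorem transferMap_apply (α : Matrix m m ℂ →ₗ[ℂ] Matrix n n ℂ) (ρ : Matrix n n ℂ)
    (B : Matrix m m ℂ) :
    transferMap α ρ B = α (B * supportInvSqrt (hsDual α ρ)) * CFC.sqrt ρ := rfl

theorem hsInner_mul_sqrt_self {ρ : Matrix n n ℂ} (hρ : 0 ≤ ρ) (B : Matrix n n ℂ) :
    hsInner (B * CFC.sqrt ρ) (B * CFC.sqrt ρ) = (B.conjTranspose * B * ρ).trace := by
  rw [hsInner, conjTranspose_mul, (isHermitian_sqrt ρ).eq, Matrix.mul_assoc, trace_mul_comm,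
    Matrix.mul_assoc, Matrix.mul_assoc, CFC.sqrt_mul_sqrt_self ρ hρ, Matrix.mul_assoc]

theorem hsInner_transferMap_le (hα : IsSchwarzMap α) (hρ : 0 ≤ ρ₂) (B : Matrix m m ℂ) :
    hsInner (transferMap α ρ₂ B) (transferMap α ρ₂ B) ≤ hsInner B B := by
  have hσ := hα.hsDual_nonneg hρ
  rw [transferMap_apply, hsInner_mul_sqrt_self hρ]
  refine (hα.trace_le hρ _).trans ?_
  generalize hsDual α ρ₂ = σ at *
  rw [conjTranspose_mul, (isHermitian_supportInvSqrt σ).eq]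
  have h := trace_mul_le (supportInvSqrt_mul_mul_supportInvSqrt_le hσ)
    (Matrix.nonneg_iff_posSemidef.2 (posSemidef_conjTranspose_mul_self B))
  rw [Matrix.one_mul] at h
  refine le_trans (le_of_eq ?_) h
  have e : supportInvSqrt σ * B.conjTranspose * (B * supportInvSqrt σ) * σ =
      supportInvSqrt σ * (B.conjTranspose * B) * (supportInvSqrt σ * σ) := by
    simp only [Matrix.mul_assoc]
  rw [e, trace_mul_comm]
  simp only [Matrix.mul_assoc]

/-- α^*(ρ₂) can be singular, so A is replaced by AP with P its support projection. Nothing changes: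
(AP - A)α^*(ρ₂) = 0, and the Schwarz inequality then forces α(AP - A)ρ₂^{1/2} = 0. -/
theorem transferMap_mul_sqrt (hα : IsSchwarzMap α) (hρ : 0 ≤ ρ₂) (A : Matrix m m ℂ) :
    transferMap α ρ₂ (A * CFC.sqrt (hsDual α ρ₂)) = α A * CFC.sqrt ρ₂ := by
  have hσ := hα.hsDual_nonneg hρ
  have h := hα.trace_le hρ (A * CFC.sqrt (hsDual α ρ₂) * supportInvSqrt (hsDual α ρ₂) - A)
  have h' : (A * CFC.sqrt (hsDual α ρ₂) * supportInvSqrt (hsDual α ρ₂) - A) * hsDual α ρ₂ = 0 := by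
    rw [Matrix.sub_mul, Matrix.mul_assoc A, Matrix.mul_assoc A, sqrt_mul_supportInvSqrt_mul hσ,
      sub_self]
  rw [Matrix.mul_assoc _ _ (hsDual α ρ₂), h', Matrix.mul_zero, trace_zero, ← hsInner_mul_sqrt_self hρ] at h
  have h0 := eq_zero_of_hsInner_self_eq_zero (le_antisymm h (hsInner_self_nonneg _))
  rw [map_sub, Matrix.sub_mul, sub_eq_zero] at h0
  rw [transferMap_apply, h0]

theorem trace_relModular_transferMap_le (hα : IsSchwarzMap α) (h₁ : 0 ≤ ρ₁) (h₂ : ρ₂.PosDef)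
    (B : Matrix m m ℂ) :
    ((transferMap α ρ₂ B).conjTranspose * ρ₁ * transferMap α ρ₂ B * supportInv ρ₂).trace ≤
      (B.conjTranspose * hsDual α ρ₁ * B * supportInv (hsDual α ρ₂)).trace := by
  have hσ := hα.hsDual_nonneg (Matrix.nonneg_iff_posSemidef.2 h₂.posSemidef)
  -- The adjoint is used because ρ₁ acts from the left: cyclicity turns the modular form at
  -- Cρ₂^{1/2} into Tr CC^*ρ₁, where the invertibility of ρ₂ cancels its powers.
  have h := hα.trace_le h₁ (B * supportInvSqrt (hsDual α ρ₂)).conjTranspose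
  rw [hα.map_conjTranspose, conjTranspose_conjTranspose, conjTranspose_conjTranspose] at h
  rw [transferMap_apply, ← supportInvSqrt_mul_self hσ]
  generalize α (B * supportInvSqrt (hsDual α ρ₂)) = C at *
  refine le_trans (le_of_eq ?_) (h.trans_eq ?_)
  · calc ((C * CFC.sqrt ρ₂).conjTranspose * ρ₁ * (C * CFC.sqrt ρ₂) * supportInv ρ₂).trace
        = (CFC.sqrt ρ₂ * (C.conjTranspose * ρ₁ * C * CFC.sqrt ρ₂ * supportInv ρ₂)).trace := by
          rw [conjTranspose_mul, (isHermitian_sqrt ρ₂).eq]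
          simp only [Matrix.mul_assoc]
      _ = (C.conjTranspose * ρ₁ * C * (CFC.sqrt ρ₂ * supportInv ρ₂ * CFC.sqrt ρ₂)).trace := by
          rw [trace_mul_comm]
          simp only [Matrix.mul_assoc]
      _ = (C * C.conjTranspose * ρ₁).trace := by
          rw [sqrt_mul_supportInv_mul_sqrt h₂, Matrix.mul_one, trace_mul_comm, Matrix.mul_assoc]
  · generalize supportInvSqrt (hsDual α ρ₂) = s, isHermitian_supportInvSqrt (hsDual α ρ₂) = hs at *
    have e : B * s * (B * s).conjTranspose * hsDual α ρ₁ =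
        B * (s * s) * (B.conjTranspose * hsDual α ρ₁) := by
      rw [conjTranspose_mul, hs.eq]
      simp only [Matrix.mul_assoc]
    rw [e, trace_mul_comm]
    simp only [Matrix.mul_assoc]

end Transfer

theorem mainTheorem3 {m n : Type*} [Fintype m] [DecidableEq m] [Fintype n] [DecidableEq n]
    (f : ℝ → ℝ) (hf : OperatorMonotone f) (hf0 : 0 ≤ f 0)
    (α : Matrix m m ℂ →ₗ[ℂ] Matrix n n ℂ) (hα : IsSchwarzMap α) (hα1 : α 1 = 1)
    (A : Matrix m m ℂ) (ρ₁ ρ₂ : Matrix n n ℂ)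
    (hρ₁ : ρ₁.PosDef) (hρ₁_tr : ρ₁.trace = 1) (hρ₂ : ρ₂.PosDef) (hρ₂_tr : ρ₂.trace = 1) :
    quasiEntropy f (α A) ρ₁ ρ₂ ≤ quasiEntropy f A (hsDual α ρ₁) (hsDual α ρ₂) := by
  have h₁ : 0 ≤ ρ₁ := Matrix.nonneg_iff_posSemidef.2 hρ₁.posSemidef
  have h₂ : 0 ≤ ρ₂ := Matrix.nonneg_iff_posSemidef.2 hρ₂.posSemidef
  have hD := relModularMatrix_nonneg h₁ h₂
  set V := LinearMap.toMatrix (stdBasis ℂ m m) (stdBasis ℂ n n) (transferMap α ρ₂) with hV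
  have hVV : V.conjTranspose * V ≤ 1 := by
    refine Matrix.le_iff.2 (.of_dotProduct_mulVec_nonneg
      (isHermitian_one.sub (isHermitian_conjTranspose_mul_self V)) fun x => ?_)
    have := star_dotProduct_conjTranspose_mul_mul_mulVec V 1 x
    rw [Matrix.mul_one] at this
    rw [sub_mulVec, dotProduct_sub, this, one_mulVec, one_mulVec, sub_nonneg,
      ← matrixUnitCoords_of x, hV, toMatrix_mulVec_matrixUnitCoords,
      star_matrixUnitCoords_dotProduct, star_matrixUnitCoords_dotProduct]
    exact hsInner_transferMap_le hα h₂ _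
  have hVDV : V.conjTranspose * relModularMatrix ρ₁ ρ₂ * V ≤
      relModularMatrix (hsDual α ρ₁) (hsDual α ρ₂) := by
    refine Matrix.le_iff.2 (.of_dotProduct_mulVec_nonneg (IsHermitian.sub
      (isHermitian_relModularMatrix
        (Matrix.nonneg_iff_posSemidef.1 (hα.hsDual_nonneg h₁)).isHermitian _)
      (isHermitian_conjTranspose_mul_mul V
        (Matrix.nonneg_iff_posSemidef.1 hD).isHermitian)) fun x => ?_)
    rw [sub_mulVec, dotProduct_sub, star_dotProduct_conjTranspose_mul_mul_mulVec, sub_nonneg,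
      ← matrixUnitCoords_of x, hV, toMatrix_mulVec_matrixUnitCoords,
      star_dotProduct_relModularMatrix_mulVec, star_dotProduct_relModularMatrix_mulVec]
    exact trace_relModular_transferMap_le hα h₁ hρ₂ _
  have key := (Matrix.le_iff.1 (hf.contraction_compression_le hf0 hVV hD hVDV)).dotProduct_mulVec_nonneg
    (matrixUnitCoords (A * CFC.sqrt (hsDual α ρ₂)))
  rw [sub_mulVec, dotProduct_sub, star_dotProduct_conjTranspose_mul_mul_mulVec, sub_nonneg, hV,
    toMatrix_mulVec_matrixUnitCoords, transferMap_mul_sqrt hα h₂] at key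
  rwa [quasiEntropy_eq_dotProduct, quasiEntropy_eq_dotProduct]
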